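/- **One-to-one Module Fixed Point Problem is in P.** A *Boolean module* with a finite set $S$ of nodes and a set $I$ of inputs assigns to every node $s\in S$ a local function $f_s:\{0,1\}^{S\cup I}\to\{0,1\}$. A label $\ell\in S\cup I$ *influences* a node $s$ if there are two configurations in $\{0,1\}^{S\cup I}$ that differ exactly at $\ell$ and on which $f_s$ takes different values; the module is *acyclic* if the digraph on $S$ with an arc $(s,s')$ whenever $s$ influences $s'$ has no directed cycle (loops included). A *one-to-one module* is an acyclic module with a single input, $I=\{\alpha\}$, and a designated output node $e\in S$. For a function $\omega:I\to S$ (a complete recursive wiring), $\circlearrowright_\omega M$ is the automata network on $S$ in which the value of $\alpha$ is replaced by the state of the node $\omega(\alpha)$: for $x\in\{0,1\}^S$, $\circlearrowright_\omega M(x)_s=f_s(x')$, where $x'$ agrees with $x$ on $S$ and $x'_\alpha=x_{\omega(\alpha)}$. A module is encoded as the list of its local functions, written as propositional formulas (variables, constants, $\neg,\wedge,\vee,\to,\leftrightarrow$) in the nodes and the input; the nodes are numbered $0,\dots,n-1$, where $n=|S|$. An instance consists of a one-to-one module $M$ and a function $\omega:I\to S$, and is written as a word over a fixed finite alphabet.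 *Statement.* There are a deterministic (multi-stack) Turing machine and a polynomial $p$ such that, for every one-to-one module $M$ and every $\omega:I\to S$, the machine, started on the encoding $w$ of $(M,\omega)$, halts after at most $p(|w|)$ steps and correctly answers whether there is a configuration $x\in\{0,1\}^S$ with $\circlearrowright_\omega M(x)=x$. -/

import Mathlib

namespace AutomataNetwork

/-! ### Modules, interaction digraphs, wirings -/

/-- A module over the alphabet `Λ` with node labels `S` and input labels `I`: every node `s` gets a
local function `Λ^(S ∪ I) → Λ` (the disjoint union of labels is the sum type `S ⊕ I`). -/
def ANModule (Λ S I : Type) : Type := S → (S ⊕ I → Λ) → Λ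

namespace ANModule

variable {Λ S I : Type}

/-- The parallel update `M(x, i)`. -/
def update (M : ANModule Λ S I) (x : S → Λ) (i : I → Λ) : S → Λ :=
  fun s => M s (Sum.elim x i)

/-- The label `l` (a node or an input) influences the node `s`: there are two configurations
that differ exactly at `l` and on which the local function of `s` takes different values. -/
def Influences (M : ANModule Λ S I) (l : S ⊕ I) (s : S) : Prop :=
  ∃ x x' : S ⊕ I → Λ, (∀ r, r ≠ l ↔ x r = x' r) ∧ M s x ≠ M s x'

/-- The interaction digraph has no directed cycle (loops included). Inputs have no incoming arc, so
only cycles through nodes matter. -/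
def IsAcyclic (M : ANModule Λ S I) : Prop :=
  ∀ s : S, ¬ Relation.TransGen (fun a b : S => M.Influences (Sum.inl a) b) s s

/-- The relabelling `ω̂` of a partial function `ω : I ⇀ S` (undefined where the value is `none`):
a wired input is sent to the node it is wired to, every other label is kept. -/
def wireLabel (ω : I → Option S) : S ⊕ I → S ⊕ {i : I // ω i = none}
  | Sum.inl s => Sum.inl s
  | Sum.inr i =>
    match h : ω i with
    | some s => Sum.inl s
    | none => Sum.inr ⟨i, h⟩

/-- The recursive wiring `↻_ω M`, a module whose inputs are those outside the domain of `ω`: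
`f'_s(x) = f_s(x ∘ ω̂)`. -/
def recWire (M : ANModule Λ S I) (ω : I → Option S) : ANModule Λ S {i : I // ω i = none} :=
  fun s x => M s (x ∘ wireLabel ω)

/-- The automata network obtained by a complete recursive wiring `ω : I → S` (all inputs are wired,
so that no input is left), as its global update function on configurations. -/
def completeWire (M : ANModule Λ S I) (ω : I → S) : (S → Λ) → (S → Λ) :=
  fun x => (M.recWire (fun i => some (ω i))).update x (fun i => nomatch i.2)

end ANModule

/-! ### Local functions written in propositional logic -/

/-- Propositional formulas with variables in `V`. -/
inductive PropFormula (V : Type) : Type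
  | var (v : V)
  | top
  | bot
  | not (φ : PropFormula V)
  | and (φ ψ : PropFormula V)
  | or (φ ψ : PropFormula V)
  | imp (φ ψ : PropFormula V)
  | iff (φ ψ : PropFormula V)

/-- The truth value of a formula under a valuation. -/
def PropFormula.eval {V : Type} (x : V → Bool) : PropFormula V → Bool
  | var v => x v
  | top => true
  | bot => false
  | not φ => !(φ.eval x)
  | and φ ψ => φ.eval x && ψ.eval x
  | or φ ψ => φ.eval x || ψ.eval x
  | imp φ ψ => !(φ.eval x) || ψ.eval x
  | iff φ ψ => φ.eval x == ψ.eval x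

/-- A Boolean module with `n` nodes and input labels `I`, given by the list of its local functions
written in propositional logic. -/
structure FormulaModule (I : Type) where
  n : ℕ
  localFn : Fin n → PropFormula (Fin n ⊕ I)

/-- The module defined by the formulas. -/
def FormulaModule.toModule {I : Type} (M : FormulaModule I) : ANModule Bool (Fin M.n) I :=
  fun s x => (M.localFn s).eval x

/-- A one-to-one module: an acyclic module with a single input (labelled `()`) and a designated
output node. Acyclicity is that of the interaction digraph of the module defined by the formulas,
not of the occurrences of variables in them. -/
structure OneToOneModule extends FormulaModule Unit where
  out : Fin n
  acyclic : toFormulaModule.toModule.IsAcyclic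

/-! ### The decision problem and its encoding -/

/-- An instance of the One-to-one Module Fixed Point Problem: a one-to-one module `M` and a
function `ω` that wires its input to a node. -/
structure FixedPointInstance where
  M : OneToOneModule
  ω : Unit → Fin M.n

/-- The question: is there a configuration `x` with `↻_ω M (x) = x`? -/
def FixedPointInstance.HasFixedPoint (P : FixedPointInstance) : Prop :=
  ∃ x : Fin P.M.n → Bool, P.M.toModule.completeWire P.ω x = x

/-- The finite alphabet in which instances are written. -/
inductive Sym
  | node | input | mark
  | top | bot | not | and | or | imp | iff
  | fn | out | wire
  deriving DecidableEq

instance : Fintype Sym where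
  elems := {.node, .input, .mark, .top, .bot, .not, .and, .or, .imp, .iff, .fn, .out, .wire}
  complete := by intro s; cases s <;> decide

/-- The number of a node, written after the symbol `c`, with one mark per unit. (Node numbers are
smaller than the number of local functions listed in the instance, so writing them in binary
instead would change the length of an instance only polynomially.) -/
def encodeNode (c : Sym) {n : ℕ} (s : Fin n) : List Sym :=
  c :: List.replicate s.val Sym.mark

/-- A formula in prefix (parenthesis-free) notation. -/
def encodeFormula {n : ℕ} : PropFormula (Fin n ⊕ Unit) → List Sym
  | .var (Sum.inl s) => encodeNode Sym.node s
  | .var (Sum.inr _) => [Sym.input]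
  | .top => [Sym.top]
  | .bot => [Sym.bot]
  | .not φ => Sym.not :: encodeFormula φ
  | .and φ ψ => Sym.and :: (encodeFormula φ ++ encodeFormula ψ)
  | .or φ ψ => Sym.or :: (encodeFormula φ ++ encodeFormula ψ)
  | .imp φ ψ => Sym.imp :: (encodeFormula φ ++ encodeFormula ψ)
  | .iff φ ψ => Sym.iff :: (encodeFormula φ ++ encodeFormula ψ)

/-- An instance is written as its output node, the node to which the input is wired, and the list of
its local functions, each of them preceded by the symbol `fn`. -/
def FixedPointInstance.encode (P : FixedPointInstance) : List Sym :=
  encodeNode Sym.out P.M.out ++ encodeNode Sym.wire (P.ω ()) ++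
    (List.ofFn fun s => Sym.fn :: encodeFormula (P.M.localFn s)).flatten

end AutomataNetwork

/-- The problem `p` about objects written by `enc` in an alphabet `Γ` is decidable in polynomial
time: some Turing machine (with finitely many stacks) computes, from the word `enc a`, the answer to
`p a`, in a number of steps bounded by a polynomial in the length of `enc a`. -/
def DecidableInPolyTime {α Γ : Type} (enc : α → List Γ) (p : α → Prop) : Prop :=
  ∃ f : α → Bool, (∀ a, f a = true ↔ p a) ∧
    Nonempty (Turing.TM2ComputableInPolyTime enc Computability.encodeBool f)

/-! A fixed point of the wired network is a fixed point of the module under some constant input `b`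
for which the wired node itself has the value `b`. In an acyclic module, the nodes that can reach a
given node form a strictly larger set along each arc, so this height is less than `n`, and after `k
≥ n` updates with a constant input the configuration no longer depends on the initial one
(`iterate_update_eq`). The limit is the unique fixed point for that input, and only two inputs have
to be tried (`exists_completeWire_eq_iff`). Acyclicity itself never has to be tested, nor an order
of the nodes computed.

Both inputs are treated at once by storing for each node a `Val`, its value as a function of the
input; there are four of these, so they can be stack symbols. The machine applies all local
functions once per symbol of the input word `w`, which is enough because `n < |w|`. Prefix formulas
are read from right to left, so one stack of values evaluates them. A pass costs `O(|w|)` steps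
(`tick_pass`), the whole run `O(|w|²)` (`leads_finish`). -/

namespace AutomataNetwork

/-! ### Fixed points of acyclic modules -/

namespace ANModule

variable {Λ S I : Type}

/-- A local function depends only on the labels that influence its node. -/
theorem apply_eq_of_influences [Finite S] [Finite I] (M : ANModule Λ S I) {s : S}
    {x y : S ⊕ I → Λ} (h : ∀ l, M.Influences l s → x l = y l) : M s x = M s y := by
  classical
  have := Fintype.ofFinite (S ⊕ I)
  suffices H : ∀ A : Finset (S ⊕ I), M s x = M s (A.piecewise y x) by
    simpa using H Finset.univ
  intro A
  induction A using Finset.induction_on with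
  | empty => simp
  | insert l A hl ih =>
    rw [ih, Finset.piecewise_insert]
    -- If switching `l` from `x l` to `y l` changed the value, the two piecewise configurations
    -- would witness that `l` influences `s`, and then `h` forces `x l = y l`.
    by_contra hne
    have hxy : x l ≠ y l := by
      intro heq
      apply hne
      congr 1
      ext r
      by_cases hr : r = l
      · subst hr; simp [hl, heq]
      · simp [hr]
    refine hxy (h l ⟨_, _, fun r => ?_, hne⟩)
    by_cases hr : r = l
    · subst hr; simpa [hl] using hxy
    · simp [hr]

/-- The number of nodes from which the node `s` can be reached by a nonempty path. -/
noncomputable def height (M : ANModule Λ S I) (s : S) : ℕ :=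
  {a | Relation.TransGen (fun a b : S => M.Influences (Sum.inl a) b) a s}.ncard

/-- Whatever reaches `a` also reaches `s`; the inclusion is strict since `a` reaches `s` but, by
acyclicity, not itself. -/
theorem height_lt_of_influences [Finite S] {M : ANModule Λ S I} (hM : M.IsAcyclic) {a s : S}
    (h : M.Influences (Sum.inl a) s) : M.height a < M.height s := by
  refine Set.ncard_lt_ncard ⟨fun b hb => Relation.TransGen.tail hb h, fun hs => ?_⟩
    (Set.toFinite _)
  exact hM a (hs (Relation.TransGen.single h))

theorem height_lt_card [Finite S] {M : ANModule Λ S I} (hM : M.IsAcyclic) (s : S) :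
    M.height s < Nat.card S := by
  rw [← Set.ncard_univ]
  refine Set.ncard_lt_ncard ⟨Set.subset_univ _, fun hs => ?_⟩ (Set.toFinite _)
  exact hM s (hs (Set.mem_univ s))

/-- With a constant input, an acyclic module forgets its initial configuration at the nodes of
height smaller than the number of updates. -/
theorem iterate_update_apply_eq [Finite S] [Finite I] {M : ANModule Λ S I} (hM : M.IsAcyclic)
    (i : I → Λ) (x y : S → Λ) (k : ℕ) {s : S} (hs : M.height s < k) :
    (fun z => M.update z i)^[k] x s = (fun z => M.update z i)^[k] y s := by
  induction k generalizing s with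
  | zero => omega
  | succ k ih =>
    rw [Function.iterate_succ_apply', Function.iterate_succ_apply']
    refine apply_eq_of_influences M ?_
    rintro (a | j) h
    · exact ih (by have := height_lt_of_influences hM h; omega)
    · rfl

theorem iterate_update_eq [Finite S] [Finite I] {M : ANModule Λ S I} (hM : M.IsAcyclic)
    (i : I → Λ) (x y : S → Λ) {k : ℕ} (hk : Nat.card S ≤ k) :
    (fun z => M.update z i)^[k] x = (fun z => M.update z i)^[k] y :=
  funext fun s => iterate_update_apply_eq hM i x y k ((height_lt_card hM s).trans_le hk)

theorem completeWire_eq_update (M : ANModule Λ S I) (ω : I → S) (x : S → Λ) :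
    M.completeWire ω x = M.update x (x ∘ ω) := by
  ext s
  change M s _ = M s _
  congr 1
  ext l
  cases l <;> rfl

/-- The fixed points of a complete wiring of an acyclic module with a single input are found by
iterating the module on each constant input. -/
theorem exists_completeWire_eq_iff [Finite S] {M : ANModule Λ S Unit} (hM : M.IsAcyclic)
    (ω : Unit → S) (x : S → Λ) {k : ℕ} (hk : Nat.card S ≤ k) :
    (∃ z, M.completeWire ω z = z) ↔
      ∃ b, (fun z => M.update z fun _ => b)^[k] x (ω ()) = b := by
  constructor
  · rintro ⟨z, hz⟩
    refine ⟨z (ω ()), ?_⟩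
    have hfix : Function.IsFixedPt (fun y => M.update y fun _ => z (ω ())) z := by
      rwa [completeWire_eq_update] at hz
    rw [iterate_update_eq hM _ x z hk, hfix.iterate k]
  · rintro ⟨b, hb⟩
    refine ⟨(fun z => M.update z fun _ => b)^[k] x, ?_⟩
    have : ((fun z => M.update z fun _ => b)^[k] x) ∘ ω = fun _ => b := funext fun _ => hb
    rw [completeWire_eq_update, this]
    -- One more update after `k` updates of `x` equals `k` updates of the updated `x`; the change of
    -- starting point is then forgotten.
    refine (Function.Commute.refl (fun z => M.update z fun _ => b)).iterate_right k x |>.trans ?_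
    exact iterate_update_eq hM _ _ _ hk

end ANModule

/-! ### Values of nodes as functions of the input -/

/-- A truth value depending on the value of the input. -/
abbrev Val : Type := Bool → Bool

/-- The value of a formula, as a function of the input, when the node `i` has the value `x[i]`. -/
def formulaVal {n : ℕ} (x : List Val) (φ : PropFormula (Fin n ⊕ Unit)) : Val :=
  fun b => φ.eval (Sum.elim (fun i : Fin n => x.getD i default b) fun _ => b)

/-- One update of all nodes. -/
def nextVals {n : ℕ} (φ : Fin n → PropFormula (Fin n ⊕ Unit)) (x : List Val) : List Val :=
  List.ofFn fun s => formulaVal x (φ s)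

theorem iterate_nextVals_getD {n : ℕ} (φ : Fin n → PropFormula (Fin n ⊕ Unit)) (x : List Val)
    (k : ℕ) (s : Fin n) (b : Bool) :
    ((nextVals φ)^[k] x).getD s default b =
      (fun z => (FormulaModule.toModule ⟨n, φ⟩).update z fun _ => b)^[k]
        (fun i : Fin n => x.getD i default b) s := by
  induction k generalizing s with
  | zero => rfl
  | succ k ih =>
    rw [Function.iterate_succ_apply', Function.iterate_succ_apply', nextVals,
      List.getD_eq_getElem _ _ (by simp)]
    simp only [List.getElem_ofFn, Fin.eta, formulaVal, ih]
    rfl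

/-- The node `i` has the value `b` on the input `b`, for some `b`. -/
def selfConsistent (x : List Val) (i : ℕ) : Bool :=
  decide (∃ b, x.getD i default b = b)

/-- The starting list is arbitrary, even in length, and `k` need only be at least `n`: the machine
can start from default values without counting the nodes. -/
theorem hasFixedPoint_iff (P : FixedPointInstance) (x : List Val) {k : ℕ} (hk : P.M.n ≤ k) :
    selfConsistent ((nextVals P.M.localFn)^[k] x) (P.ω ()) = true ↔ P.HasFixedPoint := by
  obtain ⟨⟨⟨n, φ⟩, e, hM⟩, ω⟩ := P
  simp only [selfConsistent, decide_eq_true_eq, FixedPointInstance.HasFixedPoint,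
    iterate_nextVals_getD]
  -- The starting configuration read off `x` depends on `b`; it is replaced by one that does not, as
  -- `exists_completeWire_eq_iff` requires.
  have key : ∀ b, (fun z => (FormulaModule.toModule ⟨n, φ⟩).update z fun _ => b)^[k]
      (fun i : Fin n => x.getD i default b) =
      (fun z => (FormulaModule.toModule ⟨n, φ⟩).update z fun _ => b)^[k] fun _ => false :=
    fun b => ANModule.iterate_update_eq hM _ _ _ (by simpa using hk)
  simp only [key]
  exact (ANModule.exists_completeWire_eq_iff hM ω _ (by simpa using hk)).symm

end AutomataNetwork
namespace AutomataNetwork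

/-! ### The machine -/

/-- The stacks of the machine: the unread and the read part of the input word, the current values
of the nodes, an auxiliary stack of values, the computed values, a clock, and the output. -/
inductive Stack
  | inp | rev | cur | aux | val | clock | outp
  deriving DecidableEq

instance : Fintype Stack where
  elems := {.inp, .rev, .cur, .aux, .val, .clock, .outp}
  complete := by intro k; cases k <;> decide

/-- The alphabet of each stack. -/
abbrev Stack.Alphabet : Stack → Type
  | inp | rev | clock => Sym
  | cur | aux | val => Val
  | outp => Bool

/-- All stacks have finite alphabets. -/
instance Stack.fintypeAlphabet (k : Stack) : Fintype k.Alphabet := by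
  cases k <;> dsimp only [Stack.Alphabet] <;> infer_instance

/-- The routines of the machine. -/
inductive Label
  | init | tick | restore | scan | clear | move | rewind | finish
  deriving DecidableEq

instance : Fintype Label where
  elems := {.init, .tick, .restore, .scan, .clear, .move, .rewind, .finish}
  complete := by intro l; cases l <;> decide

/-- The registers of the machine: a symbol and two values that were read, and the
answer. -/
structure Registers where
  sym : Option Sym
  fst : Option Val
  snd : Option Val
  ans : Bool
  deriving Fintype

/-- The registers at the start and in the end. -/
def Registers.initial : Registers := ⟨none, none, none, false⟩

/-- The operation denoted by a binary connective. -/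
def Sym.binary : Sym → Option (Bool → Bool → Bool)
  | and => some fun a b => a && b
  | or => some fun a b => a || b
  | imp => some fun a b => !a || b
  | iff => some fun a b => a == b
  | _ => none

/-- The value denoted by a constant or by the input. -/
def Sym.nullary : Sym → Option Val
  | top => some fun _ => true
  | bot => some fun _ => false
  | input => some fun b => b
  | _ => none

namespace Machine

open Turing TM2.Stmt

/-- Statements of the machine. -/
abbrev Stmt : Type := TM2.Stmt Stack.Alphabet Label Registers

/-- Read a symbol from a stack of symbols. -/
@[simp] def setSym (g : Registers) (a : Option Sym) : Registers := { g with sym := a }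

/-- Read a value into the first register for values. -/
@[simp] def setFst (g : Registers) (a : Option Val) : Registers := { g with fst := a }

/-- Read a value into the second register for values. -/
@[simp] def setSnd (g : Registers) (a : Option Val) : Registers := { g with snd := a }

/-- The symbol that was read last. -/
@[simp] def getSym (g : Registers) : Sym := g.sym.getD Sym.mark

/-- The value in the first register. -/
@[simp] def getFst (g : Registers) : Val := g.fst.getD default

/-- The value in the second register. -/
@[simp] def getSnd (g : Registers) : Val := g.snd.getD default

/-- Treat the symbol that was read last, when formulas are read from right to left: the operands of
a connective have been evaluated before. As many values have been moved from `cur` to `aux` as there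
are marks behind the symbol. -/
def treat : Stmt :=
  branch (fun g => getSym g = Sym.mark)
    (pop .cur setFst <| push .aux getFst <| goto fun _ => .scan) <|
  branch (fun g => getSym g = Sym.node)
    (peek .cur setFst <| push .val getFst <| goto fun _ => .restore) <|
  branch (fun g => getSym g = Sym.wire)
    (peek .cur setFst <|
      load (fun g => { g with ans := selfConsistent [getFst g] 0 }) <|
      goto fun _ => .restore) <|
  branch (fun g => getSym g = Sym.not)
    (pop .val setFst <| push .val (fun g b => !getFst g b) <| goto fun _ => .restore) <|
  branch (fun g => (getSym g).nullary.isSome)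
    (push .val (fun g => (getSym g).nullary.getD default) <| goto fun _ => .restore) <|
  branch (fun g => (getSym g).binary.isSome)
    (pop .val setFst <| pop .val setSnd <|
      push .val (fun g b => (getSym g).binary.getD default (getFst g b) (getSnd g b)) <|
      goto fun _ => .restore) <|
  goto fun _ => .restore

/-- The program: after an initialization, the module is applied once for each tick of the clock to
the values of its nodes. -/
def program : Label → Stmt
  | .init => pop .inp setSym <| branch (fun g => g.sym.isSome)
      (push .rev getSym <| push .clock getSym <| push .cur default <| goto fun _ => .init)
      (goto fun _ => .tick)
  | .tick => pop .clock setSym <| branch (fun g => g.sym.isSome)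
      (goto fun _ => .restore) (goto fun _ => .finish)
  | .restore => pop .aux setFst <| branch (fun g => g.fst.isSome)
      (push .cur getFst <| goto fun _ => .restore) (goto fun _ => .scan)
  | .scan => pop .rev setSym <| branch (fun g => g.sym.isSome)
      (push .inp getSym treat) (goto fun _ => .clear)
  | .clear => pop .cur setFst <| branch (fun g => g.fst.isSome)
      (goto fun _ => .clear) (goto fun _ => .move)
  | .move => pop .val setFst <| branch (fun g => g.fst.isSome)
      (push .aux getFst <| goto fun _ => .move) (goto fun _ => .rewind)
  | .rewind => pop .inp setSym <| branch (fun g => g.sym.isSome)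
      (push .rev getSym <| goto fun _ => .rewind) (goto fun _ => .tick)
  | .finish => pop .rev setSym <| pop .aux setFst <| branch (fun g => g.sym.isSome)
      (goto fun _ => .finish)
      (push .outp (fun g => g.ans) <| load (fun _ => Registers.initial) halt)

/-- The contents of the stacks. -/
def contents (i r : List Sym) (x y v : List Val) (c : List Sym) (o : List Bool) :
    ∀ k : Stack, List k.Alphabet
  | .inp => i
  | .rev => r
  | .cur => x
  | .aux => y
  | .val => v
  | .clock => c
  | .outp => o

section

variable (i r : List Sym) (x y v : List Val) (c : List Sym) (o : List Bool)

@[simp] theorem contents_inp : contents i r x y v c o .inp = i := rfl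
@[simp] theorem contents_rev : contents i r x y v c o .rev = r := rfl
@[simp] theorem contents_cur : contents i r x y v c o .cur = x := rfl
@[simp] theorem contents_aux : contents i r x y v c o .aux = y := rfl
@[simp] theorem contents_val : contents i r x y v c o .val = v := rfl
@[simp] theorem contents_clock : contents i r x y v c o .clock = c := rfl
@[simp] theorem contents_outp : contents i r x y v c o .outp = o := rfl

@[simp] theorem update_inp (l : List Sym) :
    Function.update (contents i r x y v c o) .inp l = contents l r x y v c o := by
  ext1 k; cases k <;> rfl
@[simp] theorem update_rev (l : List Sym) :
    Function.update (contents i r x y v c o) .rev l = contents i l x y v c o := by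
  ext1 k; cases k <;> rfl
@[simp] theorem update_cur (l : List Val) :
    Function.update (contents i r x y v c o) .cur l = contents i r l y v c o := by
  ext1 k; cases k <;> rfl
@[simp] theorem update_aux (l : List Val) :
    Function.update (contents i r x y v c o) .aux l = contents i r x l v c o := by
  ext1 k; cases k <;> rfl
@[simp] theorem update_val (l : List Val) :
    Function.update (contents i r x y v c o) .val l = contents i r x y l c o := by
  ext1 k; cases k <;> rfl
@[simp] theorem update_clock (l : List Sym) :
    Function.update (contents i r x y v c o) .clock l = contents i r x y v l o := by
  ext1 k; cases k <;> rfl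
@[simp] theorem update_outp (l : List Bool) :
    Function.update (contents i r x y v c o) .outp l = contents i r x y v c l := by
  ext1 k; cases k <;> rfl

end

/-! ### Timed reachability between snapshots -/

/-- A configuration of the running machine up to the registers other than the answer. -/
structure Snapshot where
  l : Label
  ans : Bool
  i : List Sym
  r : List Sym
  x : List Val
  y : List Val
  v : List Val
  c : List Sym

/-- The configuration of a snapshot with the given registers. -/
def Snapshot.cfg (s : Snapshot) (g : Registers) : TM2.Cfg Stack.Alphabet Label Registers :=
  ⟨some s.l, g, contents s.i s.r s.x s.y s.v s.c []⟩

/-- The machine passes from one snapshot to another one in at most `t` steps. -/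
def Leads (t : ℕ) (s s' : Snapshot) : Prop :=
  ∀ g : Registers, g.ans = s.ans → ∃ g' : Registers, g'.ans = s'.ans ∧
    Nonempty (StateTransition.EvalsToInTime (TM2.step program) (s.cfg g) (some (s'.cfg g')) t)

theorem Leads.trans {t t' : ℕ} {a b c : Snapshot} (h : Leads t a b) (h' : Leads t' b c) :
    Leads (t + t') a c := by
  intro g hg
  obtain ⟨g₁, hg₁, ⟨e₁⟩⟩ := h g hg
  obtain ⟨g₂, hg₂, ⟨e₂⟩⟩ := h' g₁ hg₁
  exact ⟨g₂, hg₂, ⟨add_comm t' t ▸ e₁.trans _ _ _ _ _ _ e₂⟩⟩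

theorem Leads.mono {t t' : ℕ} {a b : Snapshot} (h : Leads t a b) (ht : t ≤ t') :
    Leads t' a b := by
  intro g hg
  obtain ⟨g', hg', ⟨e⟩⟩ := h g hg
  exact ⟨g', hg', ⟨e.toEvalsTo, e.steps_le_m.trans ht⟩⟩

theorem Leads.refl (s : Snapshot) : Leads 0 s s :=
  fun g hg => ⟨g, hg, ⟨.refl _ _⟩⟩

theorem Leads.of_step {a b : Snapshot}
    (h : ∀ g : Registers, g.ans = a.ans → ∃ g' : Registers, g'.ans = b.ans ∧
      TM2.step program (a.cfg g) = some (b.cfg g')) : Leads 1 a b := by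
  intro g hg
  obtain ⟨g', hg', e⟩ := h g hg
  exact ⟨g', hg', ⟨⟨1, e⟩, le_rfl⟩⟩

/-! ### Single steps of the program -/

section

variable {ans : Bool} {i r : List Sym} {x y v : List Val} {c : List Sym} {a : Sym} {b d : Val}

theorem init_cons : Leads 1 ⟨.init, ans, a :: i, r, x, y, v, c⟩
    ⟨.init, ans, i, a :: r, default :: x, y, v, a :: c⟩ :=
  .of_step fun g hg => by simp [Snapshot.cfg, program, hg]

theorem init_nil : Leads 1 ⟨.init, ans, [], r, x, y, v, c⟩ ⟨.tick, ans, [], r, x, y, v, c⟩ :=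
  .of_step fun g hg => by simp [Snapshot.cfg, program, hg]

theorem tick_cons : Leads 1 ⟨.tick, ans, i, r, x, y, v, a :: c⟩
    ⟨.restore, ans, i, r, x, y, v, c⟩ :=
  .of_step fun g hg => by simp [Snapshot.cfg, program, hg]

theorem tick_nil : Leads 1 ⟨.tick, ans, i, r, x, y, v, []⟩ ⟨.finish, ans, i, r, x, y, v, []⟩ :=
  .of_step fun g hg => by simp [Snapshot.cfg, program, hg]

theorem restore_cons : Leads 1 ⟨.restore, ans, i, r, x, b :: y, v, c⟩
    ⟨.restore, ans, i, r, b :: x, y, v, c⟩ :=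
  .of_step fun g hg => by simp [Snapshot.cfg, program, hg]

theorem restore_nil : Leads 1 ⟨.restore, ans, i, r, x, [], v, c⟩
    ⟨.scan, ans, i, r, x, [], v, c⟩ :=
  .of_step fun g hg => by simp [Snapshot.cfg, program, hg]

theorem scan_nil : Leads 1 ⟨.scan, ans, i, [], x, y, v, c⟩ ⟨.clear, ans, i, [], x, y, v, c⟩ :=
  .of_step fun g hg => by simp [Snapshot.cfg, program, hg]

theorem scan_mark : Leads 1 ⟨.scan, ans, i, .mark :: r, b :: x, y, v, c⟩
    ⟨.scan, ans, .mark :: i, r, x, b :: y, v, c⟩ :=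
  .of_step fun g hg => by simp [Snapshot.cfg, program, treat, hg]

theorem scan_node : Leads 1 ⟨.scan, ans, i, .node :: r, b :: x, y, v, c⟩
    ⟨.restore, ans, .node :: i, r, b :: x, y, b :: v, c⟩ :=
  .of_step fun g hg => by simp [Snapshot.cfg, program, treat, hg]

theorem scan_wire : Leads 1 ⟨.scan, ans, i, .wire :: r, b :: x, y, v, c⟩
    ⟨.restore, selfConsistent [b] 0, .wire :: i, r, b :: x, y, v, c⟩ :=
  .of_step fun g hg => by simp [Snapshot.cfg, program, treat]

theorem scan_not : Leads 1 ⟨.scan, ans, i, .not :: r, x, y, b :: v, c⟩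
    ⟨.restore, ans, .not :: i, r, x, y, (fun e => !b e) :: v, c⟩ :=
  .of_step fun g hg => by simp [Snapshot.cfg, program, treat, hg]

theorem scan_nullary (h : a.nullary = some b) : Leads 1 ⟨.scan, ans, i, a :: r, x, y, v, c⟩
    ⟨.restore, ans, a :: i, r, x, y, b :: v, c⟩ :=
  .of_step fun g hg => by
    cases a <;> simp [Sym.nullary] at h <;> subst h <;>
      simp [Snapshot.cfg, program, treat, hg, Sym.nullary]

theorem scan_binary {f : Bool → Bool → Bool} (h : a.binary = some f) :
    Leads 1 ⟨.scan, ans, i, a :: r, x, y, b :: d :: v, c⟩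
      ⟨.restore, ans, a :: i, r, x, y, (fun e => f (b e) (d e)) :: v, c⟩ :=
  .of_step fun g hg => by
    cases a <;> simp [Sym.binary] at h <;> subst h <;>
      simp [Snapshot.cfg, program, treat, hg, Sym.nullary, Sym.binary]

theorem scan_fn : Leads 1 ⟨.scan, ans, i, .fn :: r, x, y, v, c⟩
    ⟨.restore, ans, .fn :: i, r, x, y, v, c⟩ :=
  .of_step fun g hg => by simp [Snapshot.cfg, program, treat, hg, Sym.nullary, Sym.binary]

theorem scan_out : Leads 1 ⟨.scan, ans, i, .out :: r, x, y, v, c⟩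
    ⟨.restore, ans, .out :: i, r, x, y, v, c⟩ :=
  .of_step fun g hg => by simp [Snapshot.cfg, program, treat, hg, Sym.nullary, Sym.binary]

theorem clear_cons : Leads 1 ⟨.clear, ans, i, r, b :: x, y, v, c⟩
    ⟨.clear, ans, i, r, x, y, v, c⟩ :=
  .of_step fun g hg => by simp [Snapshot.cfg, program, hg]

theorem clear_nil : Leads 1 ⟨.clear, ans, i, r, [], y, v, c⟩ ⟨.move, ans, i, r, [], y, v, c⟩ :=
  .of_step fun g hg => by simp [Snapshot.cfg, program, hg]

theorem move_cons : Leads 1 ⟨.move, ans, i, r, x, y, b :: v, c⟩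
    ⟨.move, ans, i, r, x, b :: y, v, c⟩ :=
  .of_step fun g hg => by simp [Snapshot.cfg, program, hg]

theorem move_nil : Leads 1 ⟨.move, ans, i, r, x, y, [], c⟩ ⟨.rewind, ans, i, r, x, y, [], c⟩ :=
  .of_step fun g hg => by simp [Snapshot.cfg, program, hg]

theorem rewind_cons : Leads 1 ⟨.rewind, ans, a :: i, r, x, y, v, c⟩
    ⟨.rewind, ans, i, a :: r, x, y, v, c⟩ :=
  .of_step fun g hg => by simp [Snapshot.cfg, program, hg]

theorem rewind_nil : Leads 1 ⟨.rewind, ans, [], r, x, y, v, c⟩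
    ⟨.tick, ans, [], r, x, y, v, c⟩ :=
  .of_step fun g hg => by simp [Snapshot.cfg, program, hg]

/-- One value of `aux` is discarded along with each symbol of `rev`, since only the output stack may
be nonempty at the halt. -/
theorem finish_cons : Leads 1 ⟨.finish, ans, i, a :: r, x, y, v, c⟩
    ⟨.finish, ans, i, r, x, y.tail, v, c⟩ :=
  .of_step fun g hg => by simp [Snapshot.cfg, program, hg]

end

end Machine
end AutomataNetwork
namespace AutomataNetwork
namespace Machine

open Turing

/-! ### Loops of the program and the scanning of encoded objects -/

section

variable {ans : Bool} {i r : List Sym} {x y v : List Val} {c : List Sym}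

theorem init_loop (w : List Sym) : Leads w.length ⟨.init, ans, w, r, x, y, v, c⟩
    ⟨.init, ans, [], w.reverse ++ r, List.replicate w.length default ++ x, y, v,
      w.reverse ++ c⟩ := by
  induction w generalizing r x c with
  | nil => exact .refl _
  | cons a w ih =>
    have h := init_cons.trans
      (ih (r := a :: r) (x := default :: x) (c := a :: c))
    simpa [List.replicate_succ', add_comm] using h

theorem restore_loop (y : List Val) : Leads (y.length + 1) ⟨.restore, ans, i, r, x, y, v, c⟩
    ⟨.scan, ans, i, r, y.reverse ++ x, [], v, c⟩ := by
  induction y generalizing x with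
  | nil => exact restore_nil
  | cons b y ih =>
    have h := restore_cons.trans (ih (x := b :: x))
    simpa [add_comm, add_left_comm] using h

theorem clear_loop (x : List Val) : Leads (x.length + 1) ⟨.clear, ans, i, r, x, y, v, c⟩
    ⟨.move, ans, i, r, [], y, v, c⟩ := by
  induction x with
  | nil => exact clear_nil
  | cons b x ih => simpa [add_comm] using clear_cons.trans ih

theorem move_loop (v : List Val) : Leads (v.length + 1) ⟨.move, ans, i, r, x, y, v, c⟩
    ⟨.rewind, ans, i, r, x, v.reverse ++ y, [], c⟩ := by
  induction v generalizing y with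
  | nil => exact move_nil
  | cons b v ih =>
    have h := move_cons.trans (ih (y := b :: y))
    simpa [add_comm, add_left_comm] using h

theorem rewind_loop (i : List Sym) : Leads (i.length + 1) ⟨.rewind, ans, i, r, x, y, v, c⟩
    ⟨.tick, ans, [], i.reverse ++ r, x, y, v, c⟩ := by
  induction i generalizing r with
  | nil => exact rewind_nil
  | cons a i ih =>
    have h := rewind_cons.trans (ih (r := a :: r))
    simpa [add_comm, add_left_comm] using h

theorem finish_loop (r : List Sym) : Leads r.length ⟨.finish, ans, i, r, x, y, v, c⟩
    ⟨.finish, ans, i, [], x, y.drop r.length, v, c⟩ := by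
  induction r generalizing y with
  | nil => exact .refl _
  | cons a r ih =>
    have h := (finish_cons (a := a)).trans (ih (y := y.tail))
    simpa [add_comm] using h

theorem scan_marks (p q : List Val) :
    Leads p.length ⟨.scan, ans, i, List.replicate p.length .mark ++ r, p ++ q, y, v, c⟩
      ⟨.scan, ans, List.replicate p.length .mark ++ i, r, q, p.reverse ++ y, v, c⟩ := by
  induction p generalizing i y with
  | nil => exact .refl _
  | cons b p ih =>
    have h := scan_mark.trans (ih (i := .mark :: i) (y := b :: y))
    have e : ∀ l : List Sym, List.replicate p.length Sym.mark ++ Sym.mark :: l =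
        Sym.mark :: (List.replicate p.length Sym.mark ++ l) := fun l => by
      rw [← List.cons_append, ← List.replicate_succ, List.replicate_succ', List.append_assoc]
      rfl
    simp only [List.length_cons, List.replicate_succ, List.cons_append, List.reverse_cons,
      List.append_assoc, List.nil_append, e] at h ⊢
    exact h.mono (by omega)

/-- Scan the number of a node and the symbol before it. -/
theorem scan_encodeNode {n : ℕ} {s : Fin n} (hx : n ≤ x.length) {a : Sym} {ans' : Bool}
    {v' : List Val}
    (h : ∀ i y z, Leads 1 ⟨.scan, ans, i, a :: r, x.getD s default :: z, y, v, c⟩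
      ⟨.restore, ans', a :: i, r, x.getD s default :: z, y, v', c⟩) :
    Leads (2 * (encodeNode a s).length)
      ⟨.scan, ans, i, (encodeNode a s).reverse ++ r, x, [], v, c⟩
      ⟨.scan, ans', encodeNode a s ++ i, r, x, [], v', c⟩ := by
  have hs : s.val < x.length := s.2.trans_le hx
  -- The marks behind the symbol move `p`, the first `s` values, to `aux`, which leaves the value
  -- `b` of node `s` on top of `cur`; `restore` then puts `p` back. This takes `s + 1 + (s + 1)`
  -- steps, two per symbol.
  obtain ⟨p, b, q, rfl, hp⟩ : ∃ p b q, x = p ++ b :: q ∧ p.length = s.val :=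
    ⟨x.take s, x[s.val], x.drop (s + 1), by simp, by simp [hs.le]⟩
  have hb : (p ++ b :: q).getD s default = b := by simp [← hp]
  rw [hb] at h
  have h' := ((scan_marks (ans := ans) (i := i) (r := a :: r) (y := []) (v := v) (c := c) p
    (b :: q)).trans (h _ _ q)).trans (restore_loop _)
  rw [hp] at h'
  simp only [List.append_nil, List.length_reverse, List.reverse_reverse, hp] at h'
  simp only [encodeNode, List.reverse_cons, List.reverse_replicate, List.append_assoc,
    List.cons_append, List.length_cons, List.length_replicate]
  exact h'.mono (by omega)

/-- Scan a symbol that is not preceded by marks. -/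
theorem Leads.scan_single {a : Sym} {v' : List Val}
    (h : Leads 1 ⟨.scan, ans, i, a :: r, x, [], v, c⟩ ⟨.restore, ans, a :: i, r, x, [], v', c⟩) :
    Leads 2 ⟨.scan, ans, i, a :: r, x, [], v, c⟩ ⟨.scan, ans, a :: i, r, x, [], v', c⟩ :=
  h.trans restore_nil

/-- The right operand is scanned first, so the value of the left one ends on top of the stack, which
is the order expected by `scan_binary`. -/
theorem scan_connective {n : ℕ} {a : Sym} {f : Bool → Bool → Bool} (ha : a.binary = some f)
    {b d : Val} {φ ψ : PropFormula (Fin n ⊕ Unit)}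
    (hφ : ∀ i r v, Leads (2 * (encodeFormula φ).length)
      ⟨.scan, ans, i, (encodeFormula φ).reverse ++ r, x, [], v, c⟩
      ⟨.scan, ans, encodeFormula φ ++ i, r, x, [], b :: v, c⟩)
    (hψ : ∀ i r v, Leads (2 * (encodeFormula ψ).length)
      ⟨.scan, ans, i, (encodeFormula ψ).reverse ++ r, x, [], v, c⟩
      ⟨.scan, ans, encodeFormula ψ ++ i, r, x, [], d :: v, c⟩) :
    Leads (2 * (a :: (encodeFormula φ ++ encodeFormula ψ)).length)
      ⟨.scan, ans, i, (a :: (encodeFormula φ ++ encodeFormula ψ)).reverse ++ r, x, [], v, c⟩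
      ⟨.scan, ans, (a :: (encodeFormula φ ++ encodeFormula ψ)) ++ i, r, x, [],
        (fun e => f (b e) (d e)) :: v, c⟩ := by
  have h := ((hψ i ((encodeFormula φ).reverse ++ a :: r) v).trans (hφ _ _ _)).trans
    (scan_binary ha).scan_single
  simp only [List.reverse_cons, List.reverse_append, List.append_assoc,
    List.cons_append, List.length_cons, List.length_append]
  exact h.mono (by omega)

/-- Scanning a formula pushes its value. -/
theorem scan_formula {n : ℕ} (hx : n ≤ x.length) (φ : PropFormula (Fin n ⊕ Unit)) :
    ∀ i r v, Leads (2 * (encodeFormula φ).length)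
      ⟨.scan, ans, i, (encodeFormula φ).reverse ++ r, x, [], v, c⟩
      ⟨.scan, ans, encodeFormula φ ++ i, r, x, [], formulaVal x φ :: v, c⟩ := by
  induction φ with
  | var l =>
    intro i r v
    obtain s | _ := l
    · exact scan_encodeNode hx fun _ _ _ => scan_node
    · exact (scan_nullary rfl).scan_single
  | top | bot => exact fun i r v => (scan_nullary rfl).scan_single
  | not φ ih =>
    intro i r v
    have h := (ih i (.not :: r) v).trans scan_not.scan_single
    simp only [encodeFormula, List.reverse_cons, List.append_assoc,
      List.cons_append, List.length_cons]
    exact h.mono (by omega)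
  | and φ ψ ihφ ihψ =>
    intro i r v
    have h := scan_connective (i := i) (r := r) (v := v) (a := .and) rfl ihφ ihψ
    exact h
  | or φ ψ ihφ ihψ =>
    intro i r v
    have h := scan_connective (i := i) (r := r) (v := v) (a := .or) rfl ihφ ihψ
    exact h
  | imp φ ψ ihφ ihψ =>
    intro i r v
    have h := scan_connective (i := i) (r := r) (v := v) (a := .imp) rfl ihφ ihψ
    exact h
  | iff φ ψ ihφ ihψ =>
    intro i r v
    have h := scan_connective (i := i) (r := r) (v := v) (a := .iff) rfl ihφ ihψ
    exact h

/-- Scanning a list of local functions pushes their values. -/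
theorem scan_formulas {n : ℕ} (hx : n ≤ x.length) (L : List (PropFormula (Fin n ⊕ Unit))) :
    Leads (2 * (L.map fun φ => Sym.fn :: encodeFormula φ).flatten.length)
      ⟨.scan, ans, i, (L.map fun φ => Sym.fn :: encodeFormula φ).flatten.reverse ++ r, x, [], v, c⟩
      ⟨.scan, ans, (L.map fun φ => Sym.fn :: encodeFormula φ).flatten ++ i, r, x, [],
        L.map (formulaVal x) ++ v, c⟩ := by
  induction L generalizing r with
  | nil => exact .refl _
  | cons φ L ih =>
    -- The tail of the list is scanned before its head, so the values end up on the stack in the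
    -- order of the nodes.
    have h := ((ih (r := (encodeFormula φ).reverse ++ .fn :: r)).trans
      (scan_formula hx φ _ _ _)).trans scan_fn.scan_single
    simp only [List.map_cons, List.flatten_cons, List.reverse_cons, List.reverse_append,
      List.append_assoc, List.cons_append, List.length_cons,
      List.length_append]
    exact h.mono (by omega)

/-- Scanning an instance pushes the next values of all nodes. -/
theorem scan_encode (P : FixedPointInstance) (hx : P.M.n ≤ x.length) :
    Leads (2 * P.encode.length) ⟨.scan, ans, [], P.encode.reverse, x, [], [], c⟩
      ⟨.scan, selfConsistent x (P.ω ()), P.encode, [], x, [], nextVals P.M.localFn x, c⟩ := by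
  have hL : (List.ofFn fun s => Sym.fn :: encodeFormula (P.M.localFn s)) =
      (List.ofFn P.M.localFn).map fun φ => Sym.fn :: encodeFormula φ := by
    rw [List.map_ofFn]; rfl
  have hv : nextVals P.M.localFn x = (List.ofFn P.M.localFn).map (formulaVal x) := by
    rw [List.map_ofFn]; rfl
  rw [FixedPointInstance.encode, hL, hv]
  have h := ((scan_formulas (ans := ans) (i := []) (v := []) (c := c)
    (r := (encodeNode Sym.wire (P.ω ())).reverse ++ ((encodeNode Sym.out P.M.out).reverse ++ []))
    hx (List.ofFn P.M.localFn)).trans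
    -- With `b` the value of the wired node in `x`, `selfConsistent [b] 0` is by definition
    -- `selfConsistent x (P.ω ())`.
    (scan_encodeNode hx fun _ _ _ => scan_wire)).trans
    (scan_encodeNode hx fun _ _ _ => scan_out)
  simp only [List.reverse_append, List.append_assoc, List.append_nil, List.length_append] at h ⊢
  exact h.mono (by omega)

/-! ### Clock ticks and the total running time -/

theorem length_nextVals {n : ℕ} (φ : Fin n → PropFormula (Fin n ⊕ Unit)) (x : List Val) :
    (nextVals φ x).length = n := by
  simp [nextVals]

/-- Each node contributes a symbol `fn`, and `out` and `wire` come in addition. Strictness leaves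
room for the last tick, which tests the values before its own update. -/
theorem lt_length_encode (P : FixedPointInstance) : P.M.n < P.encode.length := by
  have h : P.M.n ≤
      (List.ofFn fun s => Sym.fn :: encodeFormula (P.M.localFn s)).flatten.length := by
    rw [List.length_flatten, List.map_ofFn, List.sum_ofFn]
    refine le_trans (by simp) (Finset.sum_le_sum (f := fun _ => 1) fun s _ => ?_)
    simp
  simp only [FixedPointInstance.encode, encodeNode, List.length_append, List.length_cons]
  omega

/-- One application of the module. -/
theorem tick_pass (P : FixedPointInstance) {a : Sym} (h₁ : P.M.n ≤ (y.reverse ++ x).length)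
    (h₂ : (y.reverse ++ x).length ≤ P.encode.length) :
    Leads (6 * P.encode.length + 6) ⟨.tick, ans, [], P.encode.reverse, x, y, [], a :: c⟩
      ⟨.tick, selfConsistent (y.reverse ++ x) (P.ω ()), [], P.encode.reverse, [],
        (nextVals P.M.localFn (y.reverse ++ x)).reverse, [], c⟩ := by
  have h := (((((tick_cons (ans := ans) (a := a)).trans (restore_loop y)).trans
    (scan_encode (c := c) P h₁)).trans scan_nil).trans (clear_loop _)).trans
      ((move_loop _).trans (rewind_loop _))
  simp only [List.append_nil] at h
  -- The scan costs `2|w|`, while `restore`, `clear`, `move` and `rewind` handle at most `|w|` items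
  -- each; six single steps remain.
  refine h.mono ?_
  have := lt_length_encode P
  simp only [length_nextVals, List.length_append, List.length_reverse] at h₂ ⊢
  omega

/-- The module is applied once for each symbol on the clock. -/
theorem tick_loop (P : FixedPointInstance) {a : Sym} (c : List Sym)
    (h₁ : P.M.n ≤ (y.reverse ++ x).length) (h₂ : (y.reverse ++ x).length ≤ P.encode.length) :
    Leads ((6 * P.encode.length + 6) * (c.length + 1))
      ⟨.tick, ans, [], P.encode.reverse, x, y, [], a :: c⟩
      ⟨.tick, selfConsistent ((nextVals P.M.localFn)^[c.length] (y.reverse ++ x)) (P.ω ()), [],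
        P.encode.reverse, [], ((nextVals P.M.localFn)^[c.length + 1] (y.reverse ++ x)).reverse,
        [], []⟩ := by
  induction c generalizing ans a x y with
  | nil => simpa using tick_pass P h₁ h₂
  | cons a' c ih =>
    have hn := length_nextVals P.M.localFn (y.reverse ++ x)
    -- After a pass the values lie reversed on `aux` and `cur` is empty, whereas before the first
    -- pass they all lie on `cur`; `y.reverse ++ x` covers both cases.
    have h := (tick_pass (ans := ans) (a := a) (c := a' :: c) P h₁ h₂).trans
      (ih (by simp [hn]) (by simpa [hn] using (lt_length_encode P).le))
    simp only [List.reverse_reverse, List.append_nil] at h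
    refine h.mono (le_of_eq ?_)
    simp only [List.length_cons]
    ring

end

/-- The answer of the machine on an instance. -/
def answer (P : FixedPointInstance) : Bool :=
  selfConsistent ((nextVals P.M.localFn)^[P.encode.length - 1]
    (List.replicate P.encode.length default)) (P.ω ())

/-- Each tick tests the current values before replacing them, so the last of the `|w|` ticks sees
`|w| - 1` updates, and `n ≤ |w| - 1`. -/
theorem answer_eq_true_iff (P : FixedPointInstance) : answer P = true ↔ P.HasFixedPoint :=
  hasFixedPoint_iff P _ (Nat.le_sub_one_of_lt (lt_length_encode P))

theorem leads_finish (P : FixedPointInstance) :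
    Leads (6 * P.encode.length ^ 2 + 8 * P.encode.length + 2)
      ⟨.init, false, P.encode, [], [], [], [], []⟩
      ⟨.finish, answer P, [], [], [], [], [], []⟩ := by
  have hlt := lt_length_encode P
  obtain ⟨a, c, hc⟩ : ∃ a c, P.encode.reverse = a :: c :=
    List.exists_cons_of_ne_nil (by
      rw [ne_eq, List.reverse_eq_nil_iff, ← List.length_eq_zero_iff]; omega)
  have hlen : c.length + 1 = P.encode.length := by
    rw [← List.length_reverse (as := P.encode), hc, List.length_cons]
  have h₀ := (init_loop (ans := false) (r := []) (x := []) (y := []) (v := []) (c := [])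
    P.encode).trans init_nil
  have h₁ := tick_loop (ans := false) (x := List.replicate P.encode.length default) (y := [])
    (a := a) P c (by simpa using hlt.le) (by simp)
  -- Only `n < |w|` values are left on `aux`, so emptying `rev` empties `aux` too.
  have hd : (((nextVals P.M.localFn)^[c.length + 1]
      (List.replicate P.encode.length default)).reverse.drop P.encode.reverse.length) = [] := by
    rw [List.drop_eq_nil_iff, Function.iterate_succ_apply']
    simpa [length_nextVals] using hlt.le
  have h₂ := (tick_nil (ans := answer P) (i := []) (r := P.encode.reverse) (x := []) (v := [])
    (y := ((nextVals P.M.localFn)^[c.length + 1]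
      (List.replicate P.encode.length default)).reverse)).trans (finish_loop _)
  rw [hd] at h₂
  simp only [List.append_nil] at h₀
  -- `rev` and the clock hold the same word at this point; only the clock is to be split into `a ::
  -- c`.
  rw [show Snapshot.mk .tick false [] P.encode.reverse _ [] [] P.encode.reverse =
    Snapshot.mk .tick false [] P.encode.reverse _ [] [] (a :: c) by rw [← hc]] at h₀
  have e : answer P = selfConsistent ((nextVals P.M.localFn)^[c.length]
      ([].reverse ++ List.replicate P.encode.length default)) (P.ω ()) := by
    rw [answer, ← hlen]; rfl
  rw [← e] at h₁
  -- The bound is `|w| + 1` for the initialization, `(6|w| + 6)|w|` for the ticks and `|w| + 1` for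
  -- the cleanup.
  refine ((h₀.trans h₁).trans h₂).mono (le_of_eq ?_)
  simp only [List.length_reverse, hlen]
  ring

/-! ### The bundled machine and its polynomial time bound -/

/-- The bundled machine; the alphabets of all its stacks are finite. -/
def machine : FinTM2 where
  K := Stack
  k₀ := .inp
  k₁ := .outp
  Γ := Stack.Alphabet
  Λ := Label
  main := .init
  σ := Registers
  initialState := Registers.initial
  Γk₀Fin := Stack.fintypeAlphabet .inp
  m := program

theorem initList_machine (w : List Sym) :
    initList machine w =
      Snapshot.cfg ⟨.init, false, w, [], [], [], [], []⟩ Registers.initial := by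
  refine congrArg (TM2.Cfg.mk _ _) (funext fun k => ?_)
  cases k <;> rfl

theorem step_finish (g : Registers) {ans : Bool} (h : g.ans = ans) :
    TM2.step program (Snapshot.cfg ⟨.finish, ans, [], [], [], [], [], []⟩ g) =
      some (haltList machine [ans]) := by
  have e : (haltList machine [ans]).stk = contents [] [] [] [] [] [] [ans] :=
    funext fun k => by cases k <;> rfl
  have e' : haltList machine [ans] =
      ⟨none, Registers.initial, contents [] [] [] [] [] [] [ans]⟩ := by
    rw [← e]; rfl
  rw [e']
  simp [Snapshot.cfg, program, h]
  rfl

/-- The machine answers in quadratic time. -/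
noncomputable def outputsInTime (P : FixedPointInstance) {w : List Sym} (hw : w = P.encode) :
    TM2OutputsInTime machine w (some [answer P])
      (6 * P.encode.length ^ 2 + 8 * P.encode.length + 3) := by
  subst hw
  refine Classical.choice ?_
  obtain ⟨g, hg, ⟨e⟩⟩ := leads_finish P Registers.initial rfl
  have e₀ := initList_machine P.encode
  have e' : StateTransition.EvalsToInTime (TM2.step program)
      (Snapshot.cfg ⟨.finish, answer P, [], [], [], [], [], []⟩ g)
      (some (haltList machine [answer P])) 1 :=
    ⟨⟨1, step_finish g hg⟩, le_rfl⟩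
  rw [← e₀] at e
  have e'' := e.trans _ _ _ _ _ _ e'
  rw [add_comm 1] at e''
  exact ⟨e''⟩

end Machine

open Polynomial in
/-- The machine decides the One-to-one Module Fixed Point Problem in polynomial time. -/
noncomputable def fixedPointComputableInPolyTime :
    Turing.TM2ComputableInPolyTime FixedPointInstance.encode Computability.encodeBool
      Machine.answer where
  tm := Machine.machine
  inputAlphabet := Equiv.refl Sym
  outputAlphabet := Equiv.refl Bool
  time := 6 * X ^ 2 + 8 * X + 3
  outputsFun P := by
    have e : (6 * X ^ 2 + 8 * X + 3 : ℕ[X]).eval P.encode.length =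
        6 * P.encode.length ^ 2 + 8 * P.encode.length + 3 := by simp
    rw [e]
    exact Machine.outputsInTime P (List.map_id _)

end AutomataNetwork

theorem mainTheorem8 :
    DecidableInPolyTime AutomataNetwork.FixedPointInstance.encode
      AutomataNetwork.FixedPointInstance.HasFixedPoint :=
  ⟨AutomataNetwork.Machine.answer, AutomataNetwork.Machine.answer_eq_true_iff,
    ⟨AutomataNetwork.fixedPointComputableInPolyTime⟩⟩
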